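/- For $\varepsilon>0$, $\kappa\ge 1$, $\zeta\in(0,1)$ put $$\mathcal M(\varepsilon,\kappa,\zeta)=\frac{14}{\varepsilon^2}\bigl(\log(1+\kappa^2)\bigr)^2\log\frac2\zeta,\qquad \mathcal N(\varepsilon,\kappa)=\frac{\log\left(\frac{20}{\varepsilon}\bigl(\sqrt{2\kappa^2+1}-1\bigr)\frac{\log(1+\kappa^2)\,\log(2\kappa^2)}{\log(1+\kappa^{-2})}\right)}{\log\left(\frac{\sqrt{2\kappa^2+1}+1}{\sqrt{2\kappa^2+1}-1}\right)}.$$ **Algorithm 1** takes a positive definite $B\in\mathbb R^{d\times d}$ with eigenvalues in $[\delta,1-\delta]$ and integers $m,n\ge 0$. Let $f_\delta(x)=\log\bigl(1-\frac{(1-2\delta)x+1}{2}\bigr)$, let $T_i$ be the Chebyshev polynomials of the first kind, $x_k=\cos\frac{\pi(k+1/2)}{n+1}$, $c_0=\frac1{n+1}\sum_{k=0}^n f_\delta(x_k)$ and $c_i=\frac2{n+1}\sum_{k=0}^n f_\delta(x_k)T_i(x_k)$ for $1\le i\le n$. Let $\tilde A=\frac{1}{1-2\delta}\bigl(2(I-B)-I\bigr)$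 (with $\tilde A=0$ if $\delta=\frac12$). Draw independent random vectors $v_1,\dots,v_m\in\{-1,1\}^d$ with independent uniformly distributed coordinates. For each $v=v_i$ compute $w_0=v$, $w_1=\tilde A v$, $w_{j}=2\tilde A w_{j-1}-w_{j-2}$ for $2\le j\le n$, and $u_i=\sum_{j=0}^n c_jw_j$. The output is $\frac1m\sum_{i=1}^m v_i^\top u_i$. **Algorithm 2** takes $C\in\mathbb R^{d\times d}$ whose singular values lie in $[\sigma_{\min},\sigma_{\max}]$, where $0<\sigma_{\min}\le\sigma_{\max}$, and integers $m,n\ge 0$. Let $\Gamma_1$ be the output of Algorithm 1 for $B=\frac{1}{\sigma_{\min}^2+\sigma_{\max}^2}C^\top C$, $\delta=\frac{\sigma_{\min}^2}{\sigma_{\min}^2+\sigma_{\max}^2}$, $m$ and $n$. The output is $\Gamma=\frac12\bigl(\Gamma_1+d\log(\sigma_{\min}^2+\sigma_{\max}^2)\bigr)$. **Corollary.** Let $\varepsilon,\zeta\in(0,1)$, and let $C\in\mathbb R^{d\times d}$ be a matrix whose singular values lie in $[\sigma_{\min},\sigma_{\max}]$, where $0<\sigma_{\min}\le\sigma_{\max}<1$.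 Let $m,n$ be integers with $m,n\ge0$ and $$m\ge\mathcal M\Bigl(\varepsilon\log\tfrac1{\sigma_{\max}},\tfrac{\sigma_{\max}}{\sigma_{\min}},\zeta\Bigr),\qquad n\ge\mathcal N\Bigl(\varepsilon\log\tfrac1{\sigma_{\max}},\tfrac{\sigma_{\max}}{\sigma_{\min}}\Bigr).$$ Then the output $\Gamma$ of Algorithm 2 for $C$, $\sigma_{\min}$, $\sigma_{\max}$, $m$, $n$ satisfies $$\Pr\Bigl[\,\bigl|\log|\det C|-\Gamma\bigr|\le\varepsilon\,\bigl|\log|\det C|\bigr|\,\Bigr]\ge 1-\zeta.$$ -/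

import Mathlib

open MeasureTheory ProbabilityTheory
open scoped Matrix

namespace LogDet

/-- The node `x_k = cos (π (k + 1/2) / (n + 1))` of the Chebyshev approximation of degree `n`. -/
noncomputable def chebNode (n k : ℕ) : ℝ :=
  Real.cos (Real.pi * ((k : ℝ) + 1 / 2) / ((n : ℝ) + 1))

/-- The coefficient `c_i` of the Chebyshev approximation `∑_{i ≤ n} c_i T_i` of degree `n` of `f`. -/
noncomputable def chebCoeff (f : ℝ → ℝ) (n i : ℕ) : ℝ :=
  (if i = 0 then 1 else 2) / ((n : ℝ) + 1) *
    ∑ k ∈ Finset.range (n + 1),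
      f (chebNode n k) * (Polynomial.Chebyshev.T ℝ (i : ℤ)).eval (chebNode n k)

/-- The function on `[-1, 1]` which is approximated: `x ↦ log (1 - ((1 - 2δ) x + 1) / 2)`. It is
`log (1 - y)` composed with the affine map `g x = ((1 - 2δ) x + 1) / 2` from `[-1, 1]` onto
`[δ, 1 - δ]`. -/
noncomputable def logFun (δ x : ℝ) : ℝ :=
  Real.log (1 - ((1 - 2 * δ) * x + 1) / 2)

/-- The affine map `g⁻¹ y = (2 y - 1) / (1 - 2δ)` from `[δ, 1 - δ]` to `[-1, 1]` at a matrix. If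
`δ = 1 / 2`, then the interval is a point and the value is `0`. -/
noncomputable def rescale {d : ℕ} (δ : ℝ) (A : Matrix (Fin d) (Fin d) ℝ) :
    Matrix (Fin d) (Fin d) ℝ :=
  (1 - 2 * δ)⁻¹ • ((2 : ℝ) • A - 1)

/-- The vectors which the inner loop of the algorithm keeps. -/
structure LoopState (d : ℕ) where
  w₀ : Fin d → ℝ
  w₁ : Fin d → ℝ
  u : Fin d → ℝ

/-- The state of the inner loop after the passes `j = 2, …, t + 1`, for the matrix `A`, the
coefficients `c` and the starting vector `v`. -/
noncomputable def innerLoop {d : ℕ} (A : Matrix (Fin d) (Fin d) ℝ) (c : ℕ → ℝ) (v : Fin d → ℝ) :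
    ℕ → LoopState d
  | 0 => ⟨v, A *ᵥ v, c 0 • v + c 1 • (A *ᵥ v)⟩
  | t + 1 =>
      let s := innerLoop A c v t
      let w₂ := (2 : ℝ) • (A *ᵥ s.w₁) - s.w₀
      ⟨s.w₁, w₂, s.u + c (t + 2) • w₂⟩

/-- The vector `u` which the algorithm computes from the drawn vector `v`, for the degree `n`. -/
noncomputable def sampleVec {d : ℕ} (A : Matrix (Fin d) (Fin d) ℝ) (c : ℕ → ℝ) (v : Fin d → ℝ) :
    ℕ → (Fin d → ℝ)
  | 0 => c 0 • v
  | t + 1 => (innerLoop A c v t).u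

/-- The log-determinant estimator for a positive definite matrix `B` with eigenvalues in
`[δ, 1 - δ]`, with sampling number `m` and polynomial degree `n`, as a function of the `m` drawn
vectors `v i`. -/
noncomputable def algorithm1 {d : ℕ} (B : Matrix (Fin d) (Fin d) ℝ) (δ : ℝ) (m n : ℕ)
    (v : Fin m → Fin d → ℝ) : ℝ :=
  ∑ i : Fin m,
    (v i ⬝ᵥ sampleVec (rescale δ (1 - B)) (chebCoeff (logFun δ) n) (v i) n) / (m : ℝ)

/-- The log-determinant estimator for a nonsingular matrix `C` with singular values in
`[σmin, σmax]`, with sampling number `m` and polynomial degree `n`, as a function of the `m` drawn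
vectors `v i`. -/
noncomputable def algorithm2 {d : ℕ} (C : Matrix (Fin d) (Fin d) ℝ) (σmin σmax : ℝ) (m n : ℕ)
    (v : Fin m → Fin d → ℝ) : ℝ :=
  (algorithm1 ((1 / (σmin ^ 2 + σmax ^ 2)) • (Cᵀ * C)) (σmin ^ 2 / (σmin ^ 2 + σmax ^ 2)) m n v
    + (d : ℝ) * Real.log (σmin ^ 2 + σmax ^ 2)) / 2

/-- The threshold `𝓜(ε, κ, ζ)` for the sampling number. -/
noncomputable def sampleThreshold (ε κ ζ : ℝ) : ℝ :=
  14 / ε ^ 2 * Real.log (1 + κ ^ 2) ^ 2 * Real.log (2 / ζ)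

/-- The threshold `𝓝(ε, κ)` for the polynomial degree. -/
noncomputable def degreeThreshold (ε κ : ℝ) : ℝ :=
  Real.log (20 / ε * (Real.sqrt (2 * κ ^ 2 + 1) - 1) *
      (Real.log (1 + κ ^ 2) * Real.log (2 * κ ^ 2) / Real.log (1 + (κ ^ 2)⁻¹))) /
    Real.log ((Real.sqrt (2 * κ ^ 2 + 1) + 1) / (Real.sqrt (2 * κ ^ 2 + 1) - 1))

/-- `V 0, …, V (m - 1)` are independent Rademacher random vectors in `ℝ^d` under `P`: all their
coordinates are independent and take each of the values `1` and `-1` with probability `1/2`. -/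
structure IsRademacherSample {Ω : Type*} [MeasurableSpace Ω] (P : Measure Ω) {m d : ℕ}
    (V : Fin m → Fin d → Ω → ℝ) : Prop where
  measurable : ∀ i k, Measurable (V i k)
  prob_one : ∀ i k, P {ω | V i k ω = 1} = 1 / 2
  prob_neg_one : ∀ i k, P {ω | V i k ω = -1} = 1 / 2
  indep : iIndepFun (fun p : Fin m × Fin d => V p.1 p.2) P

/-- All the singular values of the square matrix `C` lie in `[a, b]`. -/
def SingularValuesIn {d : ℕ} (C : Matrix (Fin d) (Fin d) ℝ) (a b : ℝ) : Prop :=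
  ∀ i < d, (Matrix.toEuclideanLin C).singularValues i ∈ Set.Icc a b

end LogDet

/-! With `S = σmin² + σmax²` and `B = S⁻¹ CᵀC`, `log |det C| = (tr log B + d log S) / 2`, so only
`tr log B` has to be estimated. There are two error sources, each at most `ε' d` per sample on
average, where `ε' = ε log (1/σmax)`. Polynomial error: for `q = (κ-1)/(κ+1)` the function `logFun
δ` is, up to a constant, `log (1 - 2q cos θ + q²)`, whose Chebyshev coefficients are multiples of
`q^k/k`. Its truncation is explicit, and discrete orthogonality shows that the computed coefficients
lose at most a factor `2n+2`, which the `1/(n+1)` in the tail absorbs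
(`abs_chebApprox_logFun_sub_le`). Since `v ⬝ᵥ v = d`, a uniform error `ε'` costs `ε' d` in the
quadratic form. Sampling error: `vᵀ (log B) v` has mean `tr log B` and lies in `[-L d, 0]` with `L =
log (1 + κ²)`, so Hoeffding's inequality applies
(`IsRademacherSample.measureReal_hutchinson_ge_le`). The final halving leaves `ε' d`, and this is at
most `ε |log |det C||` because every singular value is at most `σmax < 1`. -/

namespace LogDet

/-! ### Chebyshev approximation of the logarithm -/

section Chebyshev

open Polynomial

lemma chebNode_mem (n k : ℕ) : |chebNode n k| ≤ 1 := Real.abs_cos_le_one _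

/-- Multiplied by `2 sin (h/2)`, with `h = jπ/(n+1)`, the sum telescopes to `sin (jπ) = 0`. The
range of `j` is what puts `h/2` strictly between `0` and `π`. -/
lemma sum_cos_node {n j : ℕ} (hj : 1 ≤ j) (hjn : j ≤ 2 * n + 1) :
    ∑ k ∈ Finset.range (n + 1),
      Real.cos (j * (Real.pi * ((k : ℝ) + 1 / 2) / ((n : ℝ) + 1))) = 0 := by
  have hn : (0 : ℝ) < (n : ℝ) + 1 := by positivity
  set h : ℝ := j * Real.pi / ((n : ℝ) + 1) with hh
  have hj0 : (1 : ℝ) ≤ j := by exact_mod_cast hj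
  have hj1 : (j : ℝ) ≤ 2 * n + 1 := by exact_mod_cast hjn
  have hpos : 0 < h / 2 := by have := Real.pi_pos; positivity
  have hlt : h / 2 < Real.pi := by
    rw [hh, div_div, div_lt_iff₀ (by positivity)]
    nlinarith [Real.pi_pos]
  have hs : 0 < Real.sin (h / 2) := Real.sin_pos_of_pos_of_lt_pi hpos hlt
  have key : ∀ N : ℕ, 2 * Real.sin (h / 2) * ∑ k ∈ Finset.range N,
      Real.cos (j * (Real.pi * ((k : ℝ) + 1 / 2) / ((n : ℝ) + 1))) = Real.sin (N * h) := by
    intro N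
    induction N with
    | zero => simp
    | succ N ih =>
      rw [Finset.sum_range_succ, mul_add, ih]
      have e1 : (j : ℝ) * (Real.pi * ((N : ℝ) + 1 / 2) / ((n : ℝ) + 1)) = N * h + h / 2 := by
        rw [hh]; ring
      have e2 : ((N + 1 : ℕ) : ℝ) * h = (N * h + h / 2) + h / 2 := by push_cast; ring
      have e3 : (N : ℝ) * h = (N * h + h / 2) - h / 2 := by ring
      rw [e1, e2, Real.sin_add (N * h + h / 2)]
      conv_lhs => rw [e3, Real.sin_sub]
      simp only [sub_add_cancel]
      ring
  have h1 := key (n + 1)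
  have e : ((n + 1 : ℕ) : ℝ) * h = j * Real.pi := by rw [hh]; push_cast; field_simp
  rw [e, Real.sin_nat_mul_pi] at h1
  simpa [hs.ne'] using h1

lemma eval_T_chebNode (n k i : ℕ) : (Chebyshev.T ℝ (i : ℤ)).eval (chebNode n k) =
    Real.cos (i * (Real.pi * ((k : ℝ) + 1 / 2) / ((n : ℝ) + 1))) := by
  rw [chebNode, Chebyshev.T_real_cos]; simp

/-- Orthogonality of the Chebyshev polynomials on the Chebyshev nodes. -/
lemma sum_eval_T_mul_eval_T_of_lt {n i j : ℕ} (hij : i < j) (hj : j ≤ n) :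
    ∑ k ∈ Finset.range (n + 1), (Chebyshev.T ℝ (i : ℤ)).eval (chebNode n k) *
      (Chebyshev.T ℝ (j : ℤ)).eval (chebNode n k) = 0 := by
  have h1 := sum_cos_node (n := n) (j := j - i) (by omega) (by omega)
  have h2 := sum_cos_node (n := n) (j := j + i) (by omega) (by omega)
  have : ∀ k : ℕ, (Chebyshev.T ℝ (i : ℤ)).eval (chebNode n k) *
      (Chebyshev.T ℝ (j : ℤ)).eval (chebNode n k) =
      (Real.cos ((j - i : ℕ) * (Real.pi * ((k : ℝ) + 1 / 2) / ((n : ℝ) + 1))) +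
       Real.cos ((j + i : ℕ) * (Real.pi * ((k : ℝ) + 1 / 2) / ((n : ℝ) + 1)))) / 2 := by
    intro k
    rw [eval_T_chebNode, eval_T_chebNode, Nat.cast_sub hij.le, Nat.cast_add, sub_mul, add_mul,
      Real.cos_sub, Real.cos_add]
    ring
  simp_rw [this]
  rw [← Finset.sum_div, Finset.sum_add_distrib, h1, h2]
  simp

lemma sum_eval_T_sq {n i : ℕ} (hi : i ≤ n) :
    ∑ k ∈ Finset.range (n + 1), (Chebyshev.T ℝ (i : ℤ)).eval (chebNode n k) *
      (Chebyshev.T ℝ (i : ℤ)).eval (chebNode n k) =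
    ((n : ℝ) + 1) / (if i = 0 then 1 else 2) := by
  rcases Nat.eq_zero_or_pos i with rfl | hpos
  · simp
  · have h2 := sum_cos_node (n := n) (j := 2 * i) (by omega) (by omega)
    have : ∀ k : ℕ, (Chebyshev.T ℝ (i : ℤ)).eval (chebNode n k) *
        (Chebyshev.T ℝ (i : ℤ)).eval (chebNode n k) =
        (1 + Real.cos ((2 * i : ℕ) * (Real.pi * ((k : ℝ) + 1 / 2) / ((n : ℝ) + 1)))) / 2 := by
      intro k
      rw [eval_T_chebNode, Nat.cast_mul, mul_assoc, Nat.cast_ofNat, Real.cos_two_mul]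
      ring
    simp_rw [this]
    rw [← Finset.sum_div, Finset.sum_add_distrib, h2, if_neg hpos.ne']
    simp

/-- By discrete orthogonality, the coefficient formula recovers every Chebyshev sum of degree at
most `n` exactly. -/
lemma chebCoeff_T {n i j : ℕ} (hi : i ≤ n) (hj : j ≤ n) :
    chebCoeff (fun x => (Chebyshev.T ℝ (j : ℤ)).eval x) n i = if i = j then 1 else 0 := by
  have hn : (0 : ℝ) < (n : ℝ) + 1 := by positivity
  rw [chebCoeff]
  rcases lt_trichotomy i j with h | h | h
  · simp_rw [mul_comm (eval _ (Chebyshev.T ℝ (j : ℤ)))]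
    rw [sum_eval_T_mul_eval_T_of_lt h hj, if_neg h.ne]; simp
  · subst h
    rw [sum_eval_T_sq hi, if_pos rfl]
    split_ifs <;> field_simp
  · rw [sum_eval_T_mul_eval_T_of_lt h hi, if_neg h.ne']; simp

lemma chebCoeff_sub (f g : ℝ → ℝ) (n i : ℕ) :
    chebCoeff (fun x => f x - g x) n i = chebCoeff f n i - chebCoeff g n i := by
  simp only [chebCoeff, sub_mul, Finset.sum_sub_distrib, mul_sub]

lemma chebCoeff_sum {ι : Type*} (s : Finset ι) (b : ι → ℝ) (g : ι → ℝ → ℝ) (n i : ℕ) :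
    chebCoeff (fun x => ∑ j ∈ s, b j * g j x) n i = ∑ j ∈ s, b j * chebCoeff (g j) n i := by
  simp only [chebCoeff, Finset.sum_mul, Finset.mul_sum]
  rw [Finset.sum_comm]
  exact Finset.sum_congr rfl fun j _ => Finset.sum_congr rfl fun k _ => by ring

lemma abs_chebCoeff_le {f : ℝ → ℝ} {η : ℝ} (hf : ∀ x, |x| ≤ 1 → |f x| ≤ η) (n i : ℕ) :
    |chebCoeff f n i| ≤ (if i = 0 then 1 else 2) * η := by
  have hn : (0 : ℝ) < (n : ℝ) + 1 := by positivity
  have h : |∑ k ∈ Finset.range (n + 1), f (chebNode n k) *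
      (Chebyshev.T ℝ (i : ℤ)).eval (chebNode n k)| ≤ ((n : ℝ) + 1) * η := by
    refine (Finset.abs_sum_le_sum_abs _ _).trans ?_
    refine (Finset.sum_le_card_nsmul _ _ η fun k _ => ?_).trans (by simp)
    rw [abs_mul]
    have h1 := hf _ (chebNode_mem n k)
    have h2 := Chebyshev.abs_eval_T_real_le_one (i : ℤ) (chebNode_mem n k)
    nlinarith [abs_nonneg (f (chebNode n k))]
  have hc : (0 : ℝ) ≤ (if i = 0 then 1 else 2) / ((n : ℝ) + 1) := by split_ifs <;> positivity
  rw [chebCoeff, abs_mul, abs_of_nonneg hc]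
  refine (mul_le_mul_of_nonneg_left h hc).trans (le_of_eq ?_)
  field_simp

/-- The Chebyshev approximation of degree `n` is quasi-optimal: its uniform error exceeds the
error of any other Chebyshev sum of degree `n` at most by the factor `2 n + 2`. -/
lemma abs_chebApprox_sub_le {f : ℝ → ℝ} {η : ℝ} {n : ℕ} (b : ℕ → ℝ)
    (hf : ∀ x, |x| ≤ 1 →
      |f x - ∑ j ∈ Finset.range (n + 1), b j * (Chebyshev.T ℝ (j : ℤ)).eval x| ≤ η)
    {x : ℝ} (hx : |x| ≤ 1) :
    |∑ i ∈ Finset.range (n + 1), chebCoeff f n i * (Chebyshev.T ℝ (i : ℤ)).eval x - f x| ≤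
      (2 * n + 2) * η := by
  set R : ℝ → ℝ := fun x =>
    f x - ∑ j ∈ Finset.range (n + 1), b j * (Chebyshev.T ℝ (j : ℤ)).eval x with hR
  -- The comparison sum is reproduced exactly, so only the remainder `R` contributes to the error.
  have hc : ∀ i ∈ Finset.range (n + 1), chebCoeff f n i = b i + chebCoeff R n i := by
    intro i hi
    rw [hR, chebCoeff_sub, chebCoeff_sum]
    have : ∑ j ∈ Finset.range (n + 1),
        b j * chebCoeff (fun x => (Chebyshev.T ℝ (j : ℤ)).eval x) n i = b i := by
      rw [Finset.sum_eq_single_of_mem i hi]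
      · rw [chebCoeff_T (by simpa [Nat.lt_succ_iff] using hi)
          (by simpa [Nat.lt_succ_iff] using hi)]; simp
      · intro j hj hji
        rw [chebCoeff_T (by simpa [Nat.lt_succ_iff] using hi)
          (by simpa [Nat.lt_succ_iff] using hj), if_neg hji.symm, mul_zero]
    rw [this]; ring
  have e : ∑ i ∈ Finset.range (n + 1), chebCoeff f n i * (Chebyshev.T ℝ (i : ℤ)).eval x - f x =
      ∑ i ∈ Finset.range (n + 1), chebCoeff R n i * (Chebyshev.T ℝ (i : ℤ)).eval x - R x := by
    rw [Finset.sum_congr rfl fun i hi => by rw [hc i hi]]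
    simp only [hR, add_mul, Finset.sum_add_distrib]; ring
  have hη : |R x| ≤ η := hf x hx
  have hsum : |∑ i ∈ Finset.range (n + 1), chebCoeff R n i * (Chebyshev.T ℝ (i : ℤ)).eval x| ≤
      ∑ i ∈ Finset.range (n + 1), (if i = 0 then 1 else 2) * η := by
    refine (Finset.abs_sum_le_sum_abs _ _).trans (Finset.sum_le_sum fun i _ => ?_)
    rw [abs_mul]
    have h1 := abs_chebCoeff_le hf n i
    have h2 := Chebyshev.abs_eval_T_real_le_one (i : ℤ) hx
    exact (mul_le_of_le_one_right (abs_nonneg _) h2).trans h1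
  have hcount : ∑ i ∈ Finset.range (n + 1), (if i = 0 then 1 else 2) * η = (2 * n + 1) * η := by
    rw [Finset.sum_range_succ']
    simp; ring
  rw [hcount] at hsum
  rw [e]
  refine (abs_sub _ _).trans ?_
  linarith

/-- The Chebyshev expansion of `log (1 - 2 q x + q ^ 2)` at `x = cos θ`. -/
lemma hasSum_pow_mul_cos_div {q : ℝ} (hq0 : 0 ≤ q) (hq1 : q < 1) (θ : ℝ) :
    HasSum (fun k : ℕ => q ^ k * Real.cos (k * θ) / k)
      (-(Real.log (1 - 2 * q * Real.cos θ + q ^ 2) / 2)) := by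
  -- The series is the real part of the Taylor series of `-log (1 - z)`.
  set z : ℂ := q * Complex.exp (θ * Complex.I) with hz
  have hnorm : ‖z‖ < 1 := by
    rw [hz, norm_mul, Complex.norm_exp_ofReal_mul_I]
    simpa [abs_of_nonneg hq0] using hq1
  have h := Complex.hasSum_re (Complex.hasSum_taylorSeries_neg_log hnorm)
  convert h using 1
  · ext k
    have e : z ^ k / (k : ℂ) = ((q ^ k / k : ℝ) : ℂ) * Complex.exp (((k * θ : ℝ) : ℂ) * Complex.I) := by
      rw [hz, mul_pow, ← Complex.exp_nat_mul]; push_cast; ring_nf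
    rw [e, Complex.re_ofReal_mul, Complex.exp_ofReal_mul_I_re]; ring
  · rw [Complex.neg_re, Complex.log_re]
    have e : 1 - 2 * q * Real.cos θ + q ^ 2 = ‖1 - z‖ ^ 2 := by
      rw [← Complex.normSq_eq_norm_sq, Complex.normSq_apply]
      have h1 : (1 - z).re = 1 - q * Real.cos θ := by
        rw [Complex.sub_re, hz, Complex.re_ofReal_mul, Complex.exp_ofReal_mul_I_re]; simp
      have h2 : (1 - z).im = - (q * Real.sin θ) := by
        rw [Complex.sub_im, hz, Complex.im_ofReal_mul, Complex.exp_ofReal_mul_I_im]; simp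
      rw [h1, h2]; nlinarith [Real.sin_sq_add_cos_sq θ]
    rw [e, Real.log_pow]; push_cast; ring

/-- Geometric comparison. Keeping `1/(n+1)` from the denominators is essential: it pays for the
linear loss in `abs_chebApprox_sub_le`. -/
lemma abs_tail_le {q : ℝ} (hq0 : 0 ≤ q) (hq1 : q < 1) (θ : ℝ) (n : ℕ) :
    |-(Real.log (1 - 2 * q * Real.cos θ + q ^ 2) / 2) -
      ∑ k ∈ Finset.range (n + 1), q ^ k * Real.cos (k * θ) / k| ≤
      q ^ (n + 1) / (1 - q) / ((n : ℝ) + 1) := by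
  have h := (hasSum_nat_add_iff' (n + 1)).2 (hasSum_pow_mul_cos_div hq0 hq1 θ)
  have hg : HasSum (fun k : ℕ => q ^ (n + 1) / ((n : ℝ) + 1) * q ^ k)
      (q ^ (n + 1) / ((n : ℝ) + 1) * (1 - q)⁻¹) :=
    (hasSum_geometric_of_lt_one hq0 hq1).mul_left _
  rw [← h.tsum_eq]
  have := tsum_of_norm_bounded hg (f := fun k : ℕ =>
    q ^ (k + (n + 1)) * Real.cos ((k + (n + 1) : ℕ) * θ) / (k + (n + 1) : ℕ)) (fun k => by
      rw [Real.norm_eq_abs, abs_div, abs_mul, abs_of_nonneg (pow_nonneg hq0 _), Nat.abs_cast]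
      have h1 := Real.abs_cos_le_one (((k + (n + 1) : ℕ) : ℝ) * θ)
      have h2 : (n : ℝ) + 1 ≤ ((k + (n + 1) : ℕ) : ℝ) := by
        push_cast; linarith [(Nat.cast_nonneg k : (0 : ℝ) ≤ k)]
      calc _ ≤ q ^ (k + (n + 1)) * 1 / ((n : ℝ) + 1) := by gcongr
        _ = _ := by rw [pow_add]; ring)
  rw [← Real.norm_eq_abs]
  refine this.trans (le_of_eq ?_)
  ring

/-- The error of the Chebyshev approximation of `logFun δ`, where `1 - 2 δ = 2 q / (1 + q ^ 2)`. -/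
lemma abs_chebApprox_logFun_sub_le {q δ : ℝ} (hq0 : 0 ≤ q) (hq1 : q < 1)
    (hδ : 1 - 2 * δ = 2 * q / (1 + q ^ 2)) (n : ℕ) {x : ℝ} (hx : |x| ≤ 1) :
    |∑ i ∈ Finset.range (n + 1), chebCoeff (logFun δ) n i * (Chebyshev.T ℝ (i : ℤ)).eval x -
      logFun δ x| ≤ 4 * (q ^ (n + 1) / (1 - q)) := by
  have hn : (0 : ℝ) < (n : ℝ) + 1 := by positivity
  -- The true Chebyshev coefficients of `logFun δ`. At `k = 0` the term `q ^ k / k` is `0` by the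
  -- convention for division by zero.
  set b : ℕ → ℝ := fun k =>
    (if k = 0 then - Real.log (2 * (1 + q ^ 2)) else 0) - 2 * (q ^ k / k) with hb
  refine (abs_chebApprox_sub_le (η := 2 * (q ^ (n + 1) / (1 - q) / ((n : ℝ) + 1))) b
    (fun x hx => ?_) hx).trans (le_of_eq (by field_simp; ring))
  obtain ⟨h1, h2⟩ := abs_le.1 hx
  obtain ⟨θ, rfl⟩ : ∃ θ, x = Real.cos θ := ⟨Real.arccos x, (Real.cos_arccos h1 h2).symm⟩
  have hpos : 0 < 1 - 2 * q * Real.cos θ + q ^ 2 := by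
    nlinarith [sq_nonneg (1 - q)]
  have e1 : logFun δ (Real.cos θ) =
      Real.log (1 - 2 * q * Real.cos θ + q ^ 2) - Real.log (2 * (1 + q ^ 2)) := by
    rw [← Real.log_div hpos.ne' (by positivity), logFun, hδ]
    congr 1; field_simp; ring
  have e2 : ∑ j ∈ Finset.range (n + 1), b j * (Chebyshev.T ℝ (j : ℤ)).eval (Real.cos θ) =
      - Real.log (2 * (1 + q ^ 2)) -
        2 * ∑ k ∈ Finset.range (n + 1), q ^ k * Real.cos (k * θ) / k := by
    simp only [hb, sub_mul, Finset.sum_sub_distrib, Chebyshev.T_real_cos, Finset.mul_sum]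
    congr 1
    · rw [Finset.sum_range_succ']; simp
    · refine Finset.sum_congr rfl fun k _ => ?_
      push_cast; ring
  rw [e1, e2]
  have := abs_tail_le hq0 hq1 θ n
  rw [abs_le] at this ⊢
  constructor <;> linarith [this.1, this.2]

end Chebyshev

/-! ### The recursion and the spectrum of the Gram matrix -/

section LinearAlgebra

open Polynomial

variable {d : ℕ}

/-- Pairing with a left eigenvector turns the vector recursion into the scalar three-term recursion
of the `T_i`. The initial state already contains the terms `0` and `1`, hence `range (t + 2)`. -/
lemma dotProduct_innerLoop {A : Matrix (Fin d) (Fin d) ℝ} {e : Fin d → ℝ} {x : ℝ}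
    (he : ∀ w, e ⬝ᵥ (A *ᵥ w) = x * (e ⬝ᵥ w)) (c : ℕ → ℝ) (v : Fin d → ℝ) (t : ℕ) :
    e ⬝ᵥ (innerLoop A c v t).w₀ = (Chebyshev.T ℝ (t : ℤ)).eval x * (e ⬝ᵥ v) ∧
    e ⬝ᵥ (innerLoop A c v t).w₁ = (Chebyshev.T ℝ ((t : ℤ) + 1)).eval x * (e ⬝ᵥ v) ∧
    e ⬝ᵥ (innerLoop A c v t).u =
      (∑ i ∈ Finset.range (t + 2), c i * (Chebyshev.T ℝ (i : ℤ)).eval x) * (e ⬝ᵥ v) := by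
  induction t with
  | zero =>
    simp [innerLoop, he, Finset.sum_range_succ]
    ring
  | succ t ih =>
    obtain ⟨h0, h1, h2⟩ := ih
    have hw : e ⬝ᵥ (innerLoop A c v (t + 1)).w₁ =
        (Chebyshev.T ℝ ((t : ℤ) + 2)).eval x * (e ⬝ᵥ v) := by
      simp only [innerLoop, dotProduct_sub, dotProduct_smul, he, h0, h1, Chebyshev.T_add_two]
      simp; ring
    refine ⟨by simpa [innerLoop] using h1, ?_, ?_⟩
    · rw [hw]; push_cast; ring_nf
    · have hu : (innerLoop A c v (t + 1)).u =
          (innerLoop A c v t).u + c (t + 2) • (innerLoop A c v (t + 1)).w₁ := rfl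
      rw [hu, dotProduct_add, dotProduct_smul, hw, h2, Finset.sum_range_succ _ (t + 2)]
      simp; ring

/-- In the direction of an eigenvector, the recursion evaluates the Chebyshev sum at the
eigenvalue. -/
lemma dotProduct_sampleVec {A : Matrix (Fin d) (Fin d) ℝ} {e : Fin d → ℝ} {x : ℝ}
    (he : ∀ w, e ⬝ᵥ (A *ᵥ w) = x * (e ⬝ᵥ w)) (c : ℕ → ℝ) (v : Fin d → ℝ) (n : ℕ) :
    e ⬝ᵥ sampleVec A c v n =
      (∑ i ∈ Finset.range (n + 1), c i * (Chebyshev.T ℝ (i : ℤ)).eval x) * (e ⬝ᵥ v) := by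
  cases n with
  | zero => simp [sampleVec]
  | succ t => exact (dotProduct_innerLoop he c v t).2.2

lemma sum_dotProduct_mul_dotProduct (b : OrthonormalBasis (Fin d) ℝ (EuclideanSpace ℝ (Fin d)))
    (v w : Fin d → ℝ) :
    ∑ j, ((b j : Fin d → ℝ) ⬝ᵥ v) * ((b j : Fin d → ℝ) ⬝ᵥ w) = v ⬝ᵥ w := by
  have h := b.sum_inner_mul_inner (WithLp.toLp 2 v) (WithLp.toLp 2 w)
  simpa [EuclideanSpace.inner_eq_star_dotProduct, dotProduct_comm] using h

lemma dotProduct_self_eq_one (b : OrthonormalBasis (Fin d) ℝ (EuclideanSpace ℝ (Fin d)))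
    (j : Fin d) : (b j : Fin d → ℝ) ⬝ᵥ (b j : Fin d → ℝ) = 1 := by
  have h : inner ℝ (b j) (b j) = (1 : ℝ) := by
    rw [real_inner_self_eq_norm_sq, b.norm_eq_one]; norm_num
  rw [EuclideanSpace.inner_eq_star_dotProduct] at h
  simpa only [star_trivial] using h

lemma isHermitian_transpose_mul_self_real (C : Matrix (Fin d) (Fin d) ℝ) :
    (Cᵀ * C).IsHermitian := by
  simpa using Matrix.isHermitian_conjTranspose_mul_self C

/-- Each eigenvalue of `CᵀC` is the square of some singular value; the two orderings need not be
matched. -/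
lemma eigenvalues_transpose_mul_self_mem {C : Matrix (Fin d) (Fin d) ℝ} {a b : ℝ} (ha : 0 ≤ a)
    (hC : SingularValuesIn C a b) (j : Fin d) :
    (isHermitian_transpose_mul_self_real C).eigenvalues j ∈ Set.Icc (a ^ 2) (b ^ 2) := by
  set hG := isHermitian_transpose_mul_self_real C
  set T := Matrix.toEuclideanLin C
  have hT : T.adjoint ∘ₗ T = Matrix.toEuclideanLin (Cᵀ * C) := by
    rw [← Matrix.toEuclideanLin_conjTranspose_eq_adjoint]
    ext v i
    simp [T, Matrix.toLpLin_apply, Matrix.mulVec_mulVec]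
  have hev : Module.End.HasEigenvalue (T.adjoint ∘ₗ T) (hG.eigenvalues j) := by
    refine Module.End.hasEigenvalue_of_hasEigenvector (x := hG.eigenvectorBasis j) ⟨?_, ?_⟩
    · rw [Module.End.mem_eigenspace_iff, hT]
      ext i
      have := congrFun (hG.mulVec_eigenvectorBasis j) i
      simpa [Matrix.toLpLin_apply] using this
    · exact hG.eigenvectorBasis.orthonormal.ne_zero j
  obtain ⟨i, hi⟩ := T.isSymmetric_adjoint_comp_self.exists_eigenvalues_eq
    (finrank_euclideanSpace_fin (𝕜 := ℝ) (n := d)) hev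
  have hs := T.sq_singularValues_fin (finrank_euclideanSpace_fin (𝕜 := ℝ) (n := d)) i
  have hi' : T.singularValues i ^ 2 = hG.eigenvalues j := hs.trans hi
  obtain ⟨h1, h2⟩ := hC i i.2
  rw [← hi']
  exact ⟨pow_le_pow_left₀ ha h1 2, pow_le_pow_left₀ (ha.trans h1) h2 2⟩

lemma log_abs_det_eq {C : Matrix (Fin d) (Fin d) ℝ}
    (h : ∀ j, 0 < (isHermitian_transpose_mul_self_real C).eigenvalues j) :
    Real.log |C.det| =
      (∑ j, Real.log ((isHermitian_transpose_mul_self_real C).eigenvalues j)) / 2 := by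
  have h1 : C.det ^ 2 = ∏ j, (isHermitian_transpose_mul_self_real C).eigenvalues j := by
    have := (isHermitian_transpose_mul_self_real C).det_eq_prod_eigenvalues
    rw [Matrix.det_mul, Matrix.det_transpose] at this
    rw [pow_two]; simpa using this
  rw [← Real.log_prod (fun j _ => (h j).ne'), ← h1, Real.log_abs, Real.log_pow]
  push_cast; ring

lemma eigenvector_dotProduct_rescale (C : Matrix (Fin d) (Fin d) ℝ) (s δ : ℝ) (j : Fin d)
    (w : Fin d → ℝ) :
    ((isHermitian_transpose_mul_self_real C).eigenvectorBasis j : Fin d → ℝ) ⬝ᵥ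
      (rescale δ (1 - s • (Cᵀ * C)) *ᵥ w) =
    ((1 - 2 * δ)⁻¹ * (1 - 2 * (s * (isHermitian_transpose_mul_self_real C).eigenvalues j))) *
      (((isHermitian_transpose_mul_self_real C).eigenvectorBasis j : Fin d → ℝ) ⬝ᵥ w) := by
  set hG := isHermitian_transpose_mul_self_real C
  have h : (hG.eigenvectorBasis j : Fin d → ℝ) ⬝ᵥ ((Cᵀ * C) *ᵥ w) =
      hG.eigenvalues j * ((hG.eigenvectorBasis j : Fin d → ℝ) ⬝ᵥ w) := by
    rw [Matrix.dotProduct_mulVec, ← Matrix.mulVec_transpose]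
    have ht : (Cᵀ * C)ᵀ = Cᵀ * C := by simp
    rw [ht, hG.mulVec_eigenvectorBasis j, smul_dotProduct, smul_eq_mul]
  simp only [rescale, Matrix.smul_mulVec, Matrix.sub_mulVec, Matrix.one_mulVec, dotProduct_smul,
    dotProduct_sub, h, smul_eq_mul]
  ring

end LinearAlgebra

/-! ### Concentration of the Hutchinson estimator -/

section Probability

variable {Ω : Type*} [MeasurableSpace Ω] {P : Measure Ω}

/-- Disjoint groups of independent random variables are independent. -/
lemma iIndepFun_curry {ι κ E : Type*} [MeasurableSpace E] {X : ι → κ → Ω → E}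
    (mX : ∀ i j, Measurable (X i j)) (h : iIndepFun (fun p : ι × κ => X p.1 p.2) P) :
    iIndepFun (fun i ω => (X i · ω)) P := by
  have := h.isProbabilityMeasure
  have : ∀ i j, IsProbabilityMeasure (P.map (X i j)) :=
    fun i j => Measure.isProbabilityMeasure_map (mX i j).aemeasurable
  have hrow : ∀ i, iIndepFun (X i) P := fun i =>
    h.precomp (g := fun j => (i, j)) (fun _ _ hab => (Prod.ext_iff.1 hab).2)
  rw [iIndepFun_iff_map_fun_eq_infinitePi_map (by fun_prop)]
  -- Independence is a product law: currying the joint law gives the product of the laws of the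
  -- rows.
  have e : (fun ω i j => X i j ω) =
      (MeasurableEquiv.curry ι κ E) ∘ (fun ω (p : ι × κ) => X p.1 p.2 ω) := rfl
  rw [e, ← Measure.map_map (by fun_prop) (by fun_prop),
    (iIndepFun_iff_map_fun_eq_infinitePi_map (by fun_prop)).1 h,
    Measure.infinitePi_map_curry (fun i j => P.map (X i j))]
  congr 1
  ext1 i
  rw [(iIndepFun_iff_map_fun_eq_infinitePi_map (by fun_prop)).1 (hrow i)]

/-- Two-sided Hoeffding inequality. -/
lemma measureReal_abs_sum_sub_ge_le [IsProbabilityMeasure P] {m : ℕ} {X : Fin m → Ω → ℝ}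
    {a b μ t : ℝ} (hm : ∀ i, Measurable (X i)) (hind : iIndepFun X P)
    (hb : ∀ i, ∀ᵐ ω ∂P, X i ω ∈ Set.Icc a b) (hμ : ∀ i, P[X i] = μ) (ht : 0 ≤ t) :
    P.real {ω | t ≤ |∑ i, (X i ω - μ)|} ≤ 2 * Real.exp (-(2 * t ^ 2 / (m * (b - a) ^ 2))) := by
  have hsub : ∀ i ∈ Finset.univ,
      HasSubgaussianMGF (fun ω => X i ω - μ) ((‖b - a‖₊ / 2) ^ 2) P := by
    intro i _
    have := hasSubgaussianMGF_of_mem_Icc (hm i).aemeasurable (hb i)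
    rwa [hμ i] at this
  have hind1 : iIndepFun (fun i ω => X i ω - μ) P :=
    hind.comp (fun _ x => x - μ) (fun _ => by fun_prop)
  have hind2 : iIndepFun (fun i ω => -(X i ω - μ)) P :=
    hind.comp (fun _ x => -(x - μ)) (fun _ => by fun_prop)
  have h1 := HasSubgaussianMGF.measure_sum_ge_le_of_iIndepFun hind1 hsub ht
  have h2 := HasSubgaussianMGF.measure_sum_ge_le_of_iIndepFun hind2
    (fun i hi => (hsub i hi).neg) ht
  have e : Real.exp (-t ^ 2 / (2 * ((∑ _i : Fin m, (‖b - a‖₊ / 2) ^ 2 : NNReal) : ℝ))) =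
      Real.exp (-(2 * t ^ 2 / (m * (b - a) ^ 2))) := by
    congr 1
    push_cast
    simp only [Finset.sum_const, Finset.card_univ, Fintype.card_fin, Real.norm_eq_abs, div_pow,
      sq_abs, nsmul_eq_mul]
    have e2 : (2 : ℝ) * (m * ((b - a) ^ 2 / 2 ^ 2)) = (m * (b - a) ^ 2) / 2 := by ring
    rw [e2, div_div_eq_mul_div]; ring
  rw [e] at h1 h2
  have hset : {ω | t ≤ |∑ i, (X i ω - μ)|} ⊆
      {ω | t ≤ ∑ i, (X i ω - μ)} ∪ {ω | t ≤ ∑ i, -(X i ω - μ)} := by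
    intro ω hω
    rw [Set.mem_ofPred_eq] at hω
    rcases le_abs.1 hω with h | h
    · exact Or.inl h
    · exact Or.inr (by simpa only [Set.mem_ofPred_eq, Finset.sum_neg_distrib] using h)
  calc _ ≤ P.real ({ω | t ≤ ∑ i, (X i ω - μ)} ∪ {ω | t ≤ ∑ i, -(X i ω - μ)}) :=
        measureReal_mono hset
    _ ≤ _ := measureReal_union_le _ _
    _ ≤ _ := by linarith

variable {m d : ℕ} {V : Fin m → Fin d → Ω → ℝ}

lemma IsRademacherSample.ae_eq_or [IsProbabilityMeasure P] (hV : IsRademacherSample P V)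
    (i : Fin m) (k : Fin d) : ∀ᵐ ω ∂P, V i k ω = 1 ∨ V i k ω = -1 := by
  have m1 : MeasurableSet {ω | V i k ω = 1} := hV.measurable i k (measurableSet_singleton 1)
  have m2 : MeasurableSet {ω | V i k ω = -1} := hV.measurable i k (measurableSet_singleton (-1))
  have hd : Disjoint {ω | V i k ω = 1} {ω | V i k ω = -1} := by
    rw [Set.disjoint_left]; intro ω h1 h2
    simp only [Set.mem_ofPred_eq] at h1 h2
    linarith
  have h : P ({ω | V i k ω = 1} ∪ {ω | V i k ω = -1}) = 1 := by
    rw [measure_union hd m2, hV.prob_one, hV.prob_neg_one, ENNReal.add_halves]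
  exact (prob_compl_eq_zero_iff (m1.union m2)).2 h

lemma IsRademacherSample.integral_eq_zero [IsProbabilityMeasure P] (hV : IsRademacherSample P V)
    (i : Fin m) (k : Fin d) : ∫ ω, V i k ω ∂P = 0 := by
  have m1 : MeasurableSet {ω | V i k ω = 1} := hV.measurable i k (measurableSet_singleton 1)
  have m2 : MeasurableSet {ω | V i k ω = -1} := hV.measurable i k (measurableSet_singleton (-1))
  have h : ∀ᵐ ω ∂P, V i k ω = Set.indicator {ω | V i k ω = 1} (fun _ => (1 : ℝ)) ω -
      Set.indicator {ω | V i k ω = -1} (fun _ => (1 : ℝ)) ω := by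
    filter_upwards [hV.ae_eq_or i k] with ω h
    rcases h with h | h <;> simp [Set.indicator, h] <;> norm_num
  rw [integral_congr_ae h, integral_sub ((integrable_const _).indicator m1)
    ((integrable_const _).indicator m2), integral_indicator_const _ m1,
    integral_indicator_const _ m2, Measure.real, Measure.real, hV.prob_one, hV.prob_neg_one]
  simp

lemma IsRademacherSample.integrable_mul [IsProbabilityMeasure P] (hV : IsRademacherSample P V)
    (i : Fin m) (k l : Fin d) : Integrable (fun ω => V i k ω * V i l ω) P := by
  refine Integrable.of_mem_Icc (-1) 1
    ((hV.measurable i k).mul (hV.measurable i l)).aemeasurable ?_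
  filter_upwards [hV.ae_eq_or i k, hV.ae_eq_or i l] with ω h h'
  rcases h with h | h <;> rcases h' with h' | h' <;> rw [h, h'] <;> norm_num

lemma IsRademacherSample.integral_mul [IsProbabilityMeasure P] (hV : IsRademacherSample P V)
    (i : Fin m) (k l : Fin d) : ∫ ω, V i k ω * V i l ω ∂P = if k = l then 1 else 0 := by
  split_ifs with hkl
  · subst hkl
    have h : ∀ᵐ ω ∂P, V i k ω * V i k ω = 1 := by
      filter_upwards [hV.ae_eq_or i k] with ω h
      rcases h with h | h <;> rw [h] <;> norm_num
    rw [integral_congr_ae h]; simp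
  · have hi : IndepFun (V i k) (V i l) P :=
      hV.indep.indepFun (i := (i, k)) (j := (i, l)) (by simp [hkl])
    have := hi.integral_mul_eq_mul_integral (hV.measurable i k).aestronglyMeasurable
      (hV.measurable i l).aestronglyMeasurable
    simp only [Pi.mul_apply] at this
    rw [this, hV.integral_eq_zero, zero_mul]

lemma IsRademacherSample.integral_sq_dotProduct [IsProbabilityMeasure P]
    (hV : IsRademacherSample P V) (i : Fin m) (e : Fin d → ℝ) :
    Integrable (fun ω => (e ⬝ᵥ fun k => V i k ω) ^ 2) P ∧
      ∫ ω, (e ⬝ᵥ fun k => V i k ω) ^ 2 ∂P = e ⬝ᵥ e := by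
  have h : (fun ω => (e ⬝ᵥ fun k => V i k ω) ^ 2) =
      fun ω => ∑ k, ∑ l, e k * e l * (V i k ω * V i l ω) := by
    ext ω
    simp only [dotProduct, pow_two, Finset.sum_mul_sum]
    exact Finset.sum_congr rfl fun k _ => Finset.sum_congr rfl fun l _ => by ring
  have hint : ∀ k l, Integrable (fun ω => e k * e l * (V i k ω * V i l ω)) P :=
    fun k l => (hV.integrable_mul i k l).const_mul _
  rw [h]
  refine ⟨integrable_finsetSum _ fun k _ => integrable_finsetSum _ fun l _ => hint k l, ?_⟩
  rw [integral_finsetSum _ fun k _ => integrable_finsetSum _ fun l _ => hint k l]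
  simp_rw [integral_finsetSum _ fun l _ => hint _ l, integral_const_mul, hV.integral_mul]
  simp [dotProduct]

lemma IsRademacherSample.ae_dotProduct_self [IsProbabilityMeasure P]
    (hV : IsRademacherSample P V) (i : Fin m) :
    ∀ᵐ ω ∂P, (fun k => V i k ω) ⬝ᵥ (fun k => V i k ω) = (d : ℝ) := by
  filter_upwards [ae_all_iff.2 (hV.ae_eq_or i)] with ω h
  have : ∀ k, V i k ω * V i k ω = 1 := fun k => by rcases h k with h | h <;> rw [h] <;> norm_num
  simp [dotProduct, this]

/-- Concentration of the Hutchinson trace estimator of a matrix with the orthonormal eigenvectors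
`b j` and eigenvalues `F j` in `[-L, 0]`. -/
lemma IsRademacherSample.measureReal_hutchinson_ge_le [IsProbabilityMeasure P]
    (hV : IsRademacherSample P V)
    (b : OrthonormalBasis (Fin d) ℝ (EuclideanSpace ℝ (Fin d))) {F : Fin d → ℝ} {L t : ℝ}
    (hF : ∀ j, F j ∈ Set.Icc (-L) 0) (ht : 0 ≤ t) :
    P.real {ω | t ≤ |∑ i, (∑ j, F j * ((b j : Fin d → ℝ) ⬝ᵥ fun k => V i k ω) ^ 2 -
      ∑ j, F j)|} ≤ 2 * Real.exp (-(2 * t ^ 2 / (m * (L * d) ^ 2))) := by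
  have hm : ∀ i k, Measurable (V i k) := hV.measurable
  set g : (Fin d → ℝ) → ℝ := fun v => ∑ j, F j * ((b j : Fin d → ℝ) ⬝ᵥ v) ^ 2 with hg
  have hgm : Measurable g := by
    simp only [hg, dotProduct]; fun_prop
  have hind : iIndepFun (fun i ω => g (fun k => V i k ω)) P :=
    (iIndepFun_curry hm hV.indep).comp (fun _ => g) (fun _ => hgm)
  have h := measureReal_abs_sum_sub_ge_le (P := P) (X := fun i ω => g (fun k => V i k ω))
    (a := -(L * d)) (b := 0) (μ := ∑ j, F j) (t := t)
    (fun i => hgm.comp (by fun_prop)) hind (fun i => ?_) (fun i => ?_) ht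
  · simpa using h
  · filter_upwards [hV.ae_dotProduct_self i] with ω hω
    have hs := sum_dotProduct_mul_dotProduct b (fun k => V i k ω) (fun k => V i k ω)
    rw [hω] at hs
    constructor
    -- By Parseval, the squared coordinates of the sample in the basis `b` sum to `d` almost surely.
    · rw [← hs, Finset.mul_sum, ← Finset.sum_neg_distrib]
      refine Finset.sum_le_sum fun j _ => ?_
      rw [← pow_two]
      nlinarith [(hF j).1, sq_nonneg ((b j : Fin d → ℝ) ⬝ᵥ fun k => V i k ω)]
    · exact Finset.sum_nonpos fun j _ => mul_nonpos_of_nonpos_of_nonneg (hF j).2 (sq_nonneg _)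
  · simp only [hg]
    rw [integral_finsetSum _ fun j _ => (hV.integral_sq_dotProduct i _).1.const_mul _]
    simp_rw [integral_const_mul, (hV.integral_sq_dotProduct i _).2, dotProduct_self_eq_one,
      mul_one]

end Probability

/-! ### What the two thresholds guarantee -/

section Thresholds

/-- The left side equals `2 (κ-1) q^n`. The threshold says `Q ≤ K^n`, where `K ≤ 1/q` if `q > 0`
because `κ < s`, and `Q` exceeds `2 (κ-1) / ε` with room to spare. -/
lemma four_mul_pow_div_le_of_degreeThreshold_le {ε κ : ℝ} {n : ℕ} (hε : 0 < ε) (hκ : 1 ≤ κ)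
    (hn : degreeThreshold ε κ ≤ n) :
    4 * (((κ - 1) / (κ + 1)) ^ (n + 1) / (1 - (κ - 1) / (κ + 1))) ≤ ε := by
  set s := Real.sqrt (2 * κ ^ 2 + 1) with hs
  have hs2 : s ^ 2 = 2 * κ ^ 2 + 1 := Real.sq_sqrt (by positivity)
  have hκs : κ < s := Real.lt_sqrt_of_sq_lt (by nlinarith)
  have hs1 : 0 < s - 1 := by linarith
  set K := (s + 1) / (s - 1) with hK
  have hK1 : 1 < K := by rw [hK, one_lt_div hs1]; linarith
  have hℓ : 0 < Real.log (1 + (κ ^ 2)⁻¹) := Real.log_pos (by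
    have : 0 < (κ ^ 2)⁻¹ := by positivity
    linarith)
  have hℓL : Real.log (1 + (κ ^ 2)⁻¹) ≤ Real.log (1 + κ ^ 2) := by
    have h1 : (κ ^ 2)⁻¹ ≤ κ ^ 2 := (inv_le_one_of_one_le₀ (by nlinarith)).trans (by nlinarith)
    exact Real.log_le_log (by positivity) (by linarith)
  have hL2 : Real.log 2 ≤ Real.log (2 * κ ^ 2) := Real.log_le_log (by norm_num) (by nlinarith)
  have hlog2 := Real.log_two_gt_d9
  set R := Real.log (1 + κ ^ 2) * Real.log (2 * κ ^ 2) / Real.log (1 + (κ ^ 2)⁻¹) with hR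
  -- The first logarithm dominates the denominator, and the second is at least `log 2 > 1/2`.
  have hR1 : 1 / 2 ≤ R := by
    rw [hR, le_div_iff₀ hℓ]
    nlinarith
  set Q := 20 / ε * (s - 1) * R with hQ
  have hQ0 : 0 < Q := by positivity
  have hQK : Q ≤ K ^ n := by
    have h : Real.log Q / Real.log K ≤ n := hn
    rw [div_le_iff₀ (Real.log_pos hK1), ← Real.log_pow] at h
    exact (Real.log_le_log_iff hQ0 (by positivity)).1 h
  set q := (κ - 1) / (κ + 1) with hq
  have hq0 : 0 ≤ q := div_nonneg (by linarith) (by linarith)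
  have hqK : q * K ≤ 1 := by
    rw [hq, hK, div_mul_div_comm, div_le_one (by nlinarith)]
    nlinarith
  have hqKn : q ^ n * K ^ n ≤ 1 := by
    rw [← mul_pow]
    exact pow_le_one₀ (by positivity) hqK
  have hqn : 0 ≤ q ^ n := by positivity
  have h1 : q ^ n * Q ≤ 1 := (mul_le_mul_of_nonneg_left hQK hqn).trans hqKn
  have h2 : 2 * (κ - 1) / ε ≤ Q := by
    have : Q = (20 * (s - 1) * R) / ε := by rw [hQ]; ring
    rw [this]
    refine div_le_div_of_nonneg_right ?_ hε.le
    nlinarith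
  have h3 : q ^ n * (2 * (κ - 1) / ε) ≤ 1 := (mul_le_mul_of_nonneg_left h2 hqn).trans h1
  have h4 : q ^ n * (2 * (κ - 1)) ≤ ε := by
    rwa [← mul_div_assoc, div_le_one hε] at h3
  refine le_trans (le_of_eq ?_) h4
  have : 1 - q = 2 / (κ + 1) := by rw [hq]; field_simp; ring
  rw [pow_succ, this, hq]
  field_simp
  ring

lemma two_mul_exp_le_of_sampleThreshold_le {ε κ ζ : ℝ} {m d : ℕ} (hε : 0 < ε) (hκ : 1 ≤ κ)
    (hζ : ζ ∈ Set.Ioo (0 : ℝ) 1) (hd : 0 < d) (hm : sampleThreshold ε κ ζ ≤ m) :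
    0 < m ∧ 2 * Real.exp (-(2 * (m * (ε * d)) ^ 2 / (m * (Real.log (1 + κ ^ 2) * d) ^ 2))) ≤ ζ := by
  have hL : 0 < Real.log (1 + κ ^ 2) := Real.log_pos (by nlinarith)
  have hζ' : 0 < Real.log (2 / ζ) := Real.log_pos (by
    rw [one_lt_div hζ.1]; linarith [hζ.2])
  rw [sampleThreshold] at hm
  have hm0 : (0 : ℝ) < m := lt_of_lt_of_le (by positivity) hm
  have hd0 : (0 : ℝ) < d := by exact_mod_cast hd
  refine ⟨by exact_mod_cast hm0, ?_⟩
  set L := Real.log (1 + κ ^ 2)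
  have e : 2 * (m * (ε * d)) ^ 2 / (m * (L * d) ^ 2) = 2 * (m * (ε ^ 2 / L ^ 2)) := by
    field_simp
  -- Hoeffding would need only `1/2` in place of `14`.
  have h : 14 * Real.log (2 / ζ) ≤ m * (ε ^ 2 / L ^ 2) := by
    refine le_trans (le_of_eq ?_) (mul_le_mul_of_nonneg_right hm (by positivity))
    field_simp
  rw [e]
  calc 2 * Real.exp (-(2 * (m * (ε ^ 2 / L ^ 2)))) ≤ 2 * Real.exp (-Real.log (2 / ζ)) := by
        gcongr; linarith
    _ = ζ := by
        rw [Real.exp_neg, Real.exp_log (div_pos two_pos hζ.1)]; field_simp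

end Thresholds

/-! ### Error of one sample and the change of variables -/

section Estimator

variable {d : ℕ}

/-- Each sample of the estimator is close to the quadratic form of the exact matrix logarithm. -/
lemma abs_dotProduct_sampleVec_sub_le {A : Matrix (Fin d) (Fin d) ℝ} {f : ℝ → ℝ}
    (b : OrthonormalBasis (Fin d) ℝ (EuclideanSpace ℝ (Fin d))) {x : Fin d → ℝ}
    (hA : ∀ j w, (b j : Fin d → ℝ) ⬝ᵥ (A *ᵥ w) = x j * ((b j : Fin d → ℝ) ⬝ᵥ w))
    {c : ℕ → ℝ} {n : ℕ} {η : ℝ}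
    (hf : ∀ j, |∑ i ∈ Finset.range (n + 1),
      c i * (Polynomial.Chebyshev.T ℝ (i : ℤ)).eval (x j) - f (x j)| ≤ η) (v : Fin d → ℝ) :
    |v ⬝ᵥ sampleVec A c v n - ∑ j, f (x j) * ((b j : Fin d → ℝ) ⬝ᵥ v) ^ 2| ≤ η * (v ⬝ᵥ v) := by
  rw [← sum_dotProduct_mul_dotProduct b v (sampleVec A c v n),
    ← sum_dotProduct_mul_dotProduct b v v, ← Finset.sum_sub_distrib, Finset.mul_sum]
  refine (Finset.abs_sum_le_sum_abs _ _).trans (Finset.sum_le_sum fun j _ => ?_)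
  rw [dotProduct_sampleVec (hA j)]
  have e : ((b j : Fin d → ℝ) ⬝ᵥ v) * ((∑ i ∈ Finset.range (n + 1),
      c i * (Polynomial.Chebyshev.T ℝ (i : ℤ)).eval (x j)) * ((b j : Fin d → ℝ) ⬝ᵥ v)) -
      f (x j) * ((b j : Fin d → ℝ) ⬝ᵥ v) ^ 2 =
      (∑ i ∈ Finset.range (n + 1), c i * (Polynomial.Chebyshev.T ℝ (i : ℤ)).eval (x j) - f (x j)) *
        (((b j : Fin d → ℝ) ⬝ᵥ v) * ((b j : Fin d → ℝ) ⬝ᵥ v)) := by ring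
  rw [e, abs_mul, abs_of_nonneg (mul_self_nonneg ((b j : Fin d → ℝ) ⬝ᵥ v))]
  exact mul_le_mul_of_nonneg_right (hf j) (mul_self_nonneg _)

lemma abs_rescaled_le_one {δ y : ℝ} (hδ : δ ≤ 1 / 2) (hy : y ∈ Set.Icc δ (1 - δ)) :
    |(1 - 2 * δ)⁻¹ * (1 - 2 * y)| ≤ 1 := by
  obtain ⟨h1, h2⟩ := hy
  have h : |1 - 2 * y| ≤ 1 - 2 * δ := abs_le.2 ⟨by linarith, by linarith⟩
  rw [abs_mul, abs_inv, abs_of_nonneg (by linarith : (0 : ℝ) ≤ 1 - 2 * δ), inv_mul_eq_div]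
  exact div_le_one_of_le₀ h (by linarith)

/-- The reflection `B ↦ I - B` in the algorithm cancels the `1 - ·` inside `logFun`. If `δ = 1/2`,
the inverse is `0`, but then `y = 1/2` is forced. -/
lemma logFun_rescaled {δ y : ℝ} (hy : y ∈ Set.Icc δ (1 - δ)) :
    logFun δ ((1 - 2 * δ)⁻¹ * (1 - 2 * y)) = Real.log y := by
  obtain ⟨h1, h2⟩ := hy
  rw [logFun]
  congr 1
  rcases eq_or_ne (1 - 2 * δ) 0 with h | h
  · rw [h]; linarith
  · rw [mul_inv_cancel_left₀ h]; ring

end Estimator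

end LogDet

/-! ### The relative error bound -/

theorem corollary1 {Ω : Type*} [MeasurableSpace Ω] (P : Measure Ω) [IsProbabilityMeasure P]
    {d : ℕ} (C : Matrix (Fin d) (Fin d) ℝ) (σmin σmax ε ζ : ℝ)
    (hε : ε ∈ Set.Ioo (0 : ℝ) 1) (hζ : ζ ∈ Set.Ioo (0 : ℝ) 1)
    (hσmin : 0 < σmin) (hσ : σmin ≤ σmax) (hσmax : σmax < 1)
    (hC : LogDet.SingularValuesIn C σmin σmax)
    (m n : ℕ)
    (hm : LogDet.sampleThreshold (ε * Real.log (1 / σmax)) (σmax / σmin) ζ ≤ (m : ℝ))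
    (hn : LogDet.degreeThreshold (ε * Real.log (1 / σmax)) (σmax / σmin) ≤ (n : ℝ))
    (V : Fin m → Fin d → Ω → ℝ) (hV : LogDet.IsRademacherSample P V) :
    1 - ζ ≤ P.real {ω | |Real.log (|C.det|) -
        LogDet.algorithm2 C σmin σmax m n (fun i k => V i k ω)| ≤
      ε * |Real.log (|C.det|)|} := by
  open LogDet in
  -- For `d = 0` the Hoeffding exponent degenerates to `0`, but both `log |det C|` and the output
  -- vanish.
  rcases Nat.eq_zero_or_pos d with rfl | hd
  · simp [algorithm2, algorithm1, hζ.1.le]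
  have hσmax0 : 0 < σmax := hσmin.trans_le hσ
  have hlog : 0 < Real.log (1 / σmax) := Real.log_pos (by rw [one_lt_div hσmax0]; exact hσmax)
  set ε' := ε * Real.log (1 / σmax) with hε'
  have hε'0 : 0 < ε' := mul_pos hε.1 hlog
  set κ := σmax / σmin with hκdef
  have hκ : 1 ≤ κ := (one_le_div hσmin).2 hσ
  set S := σmin ^ 2 + σmax ^ 2 with hS
  have hS0 : 0 < S := by positivity
  set δ := σmin ^ 2 / S with hδ
  have hδ0 : 0 < δ := by positivity
  have hsq : σmin ^ 2 ≤ σmax ^ 2 := pow_le_pow_left₀ hσmin.le hσ 2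
  have hδhalf : δ ≤ 1 / 2 := by rw [hδ, div_le_div_iff₀ hS0 two_pos]; linarith
  have hδ' : 1 - δ = σmax ^ 2 / S := by rw [hδ]; field_simp; rw [hS]; ring
  set hG := isHermitian_transpose_mul_self_real C
  set b := hG.eigenvectorBasis
  set μ := hG.eigenvalues
  have hμ : ∀ j, μ j ∈ Set.Icc (σmin ^ 2) (σmax ^ 2) :=
    eigenvalues_transpose_mul_self_mem hσmin.le hC
  have hμ0 : ∀ j, 0 < μ j := fun j => (pow_pos hσmin 2).trans_le (hμ j).1
  have hy : ∀ j, 1 / S * μ j ∈ Set.Icc δ (1 - δ) := fun j => by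
    rw [hδ', hδ, one_div, inv_mul_eq_div]
    exact ⟨by gcongr; exact (hμ j).1, by gcongr; exact (hμ j).2⟩
  set F : Fin d → ℝ := fun j => Real.log (1 / S * μ j) with hFdef
  have hF : ∀ j, F j ∈ Set.Icc (-Real.log (1 + κ ^ 2)) 0 := fun j => by
    have e : -Real.log (1 + κ ^ 2) = Real.log δ := by
      rw [← Real.log_inv]
      congr 1
      rw [hδ, hS, hκdef]; field_simp
    rw [e]
    exact ⟨Real.log_le_log hδ0 (hy j).1,
      Real.log_nonpos (hδ0.le.trans (hy j).1) ((hy j).2.trans (by linarith))⟩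
  set x : Fin d → ℝ := fun j => (1 - 2 * δ)⁻¹ * (1 - 2 * (1 / S * μ j)) with hx
  have hfx : ∀ j, logFun δ (x j) = F j := fun j => logFun_rescaled (hy j)
  have happrox : ∀ j, |∑ i ∈ Finset.range (n + 1), chebCoeff (logFun δ) n i *
      (Polynomial.Chebyshev.T ℝ (i : ℤ)).eval (x j) - logFun δ (x j)| ≤ ε' := fun j => by
    -- This `q` solves `2q / (1 + q²) = (κ² - 1) / (κ² + 1) = 1 - 2δ`.
    refine (abs_chebApprox_logFun_sub_le (q := (κ - 1) / (κ + 1))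
      (div_nonneg (by linarith) (by linarith)) ((div_lt_one (by linarith)).2 (by linarith)) ?_ n
      (abs_rescaled_le_one hδhalf (hy j))).trans
      (four_mul_pow_div_le_of_degreeThreshold_le hε'0 hκ hn)
    rw [hδ, hS, hκdef]; field_simp; ring
  obtain ⟨hm0, htail⟩ := two_mul_exp_le_of_sampleThreshold_le hε'0 hκ hζ hd hm
  have hm0' : (0 : ℝ) < m := by exact_mod_cast hm0
  have hbad := (hV.measureReal_hutchinson_ge_le b hF
    (t := m * (ε' * d)) (by positivity)).trans htail
  have hdet : Real.log |C.det| = (∑ j, F j + d * Real.log S) / 2 := by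
    rw [log_abs_det_eq hμ0]
    congr 1
    have : ∀ j, F j = Real.log (μ j) - Real.log S := fun j => by
      simp only [hFdef, one_div, inv_mul_eq_div]
      exact Real.log_div (hμ0 j).ne' hS0.ne'
    simp [this]
    rfl
  -- Here the additive error becomes relative: `-log |det C| ≥ d log (1/σmax)`.
  have hdet_ge : ε' * d ≤ ε * |Real.log (|C.det|)| := by
    rw [hε', mul_assoc]
    refine mul_le_mul_of_nonneg_left (le_trans ?_ (neg_le_abs _)) hε.1.le
    rw [log_abs_det_eq hμ0, one_div, Real.log_inv]
    have : ∑ j, Real.log (μ j) ≤ ∑ _j : Fin d, 2 * Real.log σmax :=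
      Finset.sum_le_sum fun j _ => by
        have := Real.log_le_log (hμ0 j) (hμ j).2
        rw [Real.log_pow] at this
        exact_mod_cast this
    simp only [Finset.sum_const, Finset.card_univ, Fintype.card_fin, nsmul_eq_mul] at this
    linarith
  set bad : Set Ω := {ω | m * (ε' * d) ≤ |∑ i, (∑ j, F j * ((b j : Fin d → ℝ) ⬝ᵥ fun k => V i k ω) ^ 2 -
        ∑ j, F j)|} with hbad_def
  set good : Set Ω := {ω | |Real.log (|C.det|) -
        algorithm2 C σmin σmax m n (fun i k => V i k ω)| ≤ ε * |Real.log (|C.det|)|} with hgood_def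
  -- Only almost sure, since the samples are `±1` only almost surely. The union bound then avoids
  -- any measurability question about `good`.
  have hcover : ∀ᵐ ω ∂P, ω ∈ good ∪ bad := by
    filter_upwards [ae_all_iff.2 hV.ae_dotProduct_self] with ω hω
    rw [Set.mem_union, or_iff_not_imp_right]
    intro hnot
    rw [hbad_def, Set.mem_ofPred_eq, not_le] at hnot
    rw [hgood_def, Set.mem_ofPred_eq]
    refine le_trans ?_ hdet_ge
    set u : Fin m → ℝ := fun i => (fun k => V i k ω) ⬝ᵥ
      sampleVec (rescale δ (1 - (1 / S) • (Cᵀ * C))) (chebCoeff (logFun δ) n)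
        (fun k => V i k ω) n with hu
    have hui : ∀ i, |u i - ∑ j, F j * ((b j : Fin d → ℝ) ⬝ᵥ fun k => V i k ω) ^ 2| ≤ ε' * d := by
      intro i
      have := abs_dotProduct_sampleVec_sub_le b (x := x)
        (fun j w => eigenvector_dotProduct_rescale C (1 / S) δ j w) happrox (fun k => V i k ω)
      rw [hω i] at this
      simp only [hfx] at this
      exact this
    have hsum : |∑ i, (u i - ∑ j, F j * ((b j : Fin d → ℝ) ⬝ᵥ fun k => V i k ω) ^ 2)| ≤
        m * (ε' * d) := by
      refine (Finset.abs_sum_le_sum_abs _ _).trans ?_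
      refine (Finset.sum_le_card_nsmul _ _ _ fun i _ => hui i).trans (by simp)
    -- Polynomial error plus sampling error; off `bad` each sum is at most `m ε' d`, and dividing by
    -- `2m` leaves `ε' d`.
    have hΓ : Real.log |C.det| - algorithm2 C σmin σmax m n (fun i k => V i k ω) =
        -((∑ i, (u i - ∑ j, F j * ((b j : Fin d → ℝ) ⬝ᵥ fun k => V i k ω) ^ 2)) +
          ∑ i, (∑ j, F j * ((b j : Fin d → ℝ) ⬝ᵥ fun k => V i k ω) ^ 2 - ∑ j, F j)) /
          (2 * m) := by
      have h1 : algorithm2 C σmin σmax m n (fun i k => V i k ω) =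
          ((∑ i, u i) / m + d * Real.log S) / 2 := by
        rw [Finset.sum_div]; rfl
      rw [h1, hdet, ← Finset.sum_add_distrib]
      simp only [sub_add_sub_cancel, Finset.sum_sub_distrib, Finset.sum_const, Finset.card_univ,
        Fintype.card_fin, nsmul_eq_mul]
      field_simp
      ring
    rw [hΓ, abs_div, abs_neg, abs_of_pos (by positivity : (0 : ℝ) < 2 * m),
      div_le_iff₀ (by positivity)]
    refine (abs_add_le _ _).trans ?_
    linarith
  have h1 : P.real (good ∪ bad) = 1 := by
    exact (measureReal_congr (Filter.eventuallyEq_univ.2 hcover)).trans probReal_univ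
  have h2 := measureReal_union_le (μ := P) good bad
  linarith
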